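/- Let $q$ be a prime power and let $m\ge 4$ be an even integer. Then there exists a connected strongly regular graph with parameters $$N=q^m,\qquad K=\frac{q^m-1}{q+1},$$ $$\lambda=\frac{q^{m}-3q-2-(-1)^{\frac m2}q^{\frac m2+1}(q-1)}{(q+1)^2},\qquad \mu=\frac{q\left(q^{\frac m2}-(-1)^{\frac m2}\right)\left(q^{\frac m2-1}+(-1)^{\frac m2}\right)}{(q+1)^2},$$ that is, a connected graph on $N$ vertices, regular of valency $K$, in which two distinct vertices have $\lambda$ common neighbours if they are adjacent and $\mu$ if they are not; in particular these numbers are non-negative integers. Moreover such a graph comes from a code, as follows. Put $$D=\{x\in\mathbb F_{q^m}^*:\operatorname{Tr}_{\mathbb F_{q^2}/\mathbb F_q}(\mathrm N_{\mathbb F_{q^m}/\mathbb F_{q^2}}(x))=0\}.$$ There is a set $D_1=\{d_1,\dots,d_n\}$ with $D=\mathbb F_q^*D_1$ and $d_i/d_j\notin\mathbb F_q^*$ for all $i\ne j$, and for every such $D_1$ one has $n=\frac{q^m-1}{q^2-1}$, and the linear code $$\mathcal C_{D_1}=\{(\operatorname{Tr}_{\mathbb F_{q^m}/\mathbb F_q}(xd_1),\dots,\operatorname{Tr}_{\mathbb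 F_{q^m}/\mathbb F_q}(xd_n)):x\in\mathbb F_{q^m}\}$$ over $\mathbb F_q$ has dimension $m$, is projective (the minimum distance of its dual code is at least $3$), and is a two-weight code (its nonzero codewords have exactly two distinct Hamming weights). If $g_1,\dots,g_n\in\mathbb F_q^m$ are the columns of a generator matrix of $\mathcal C_{D_1}$, then the graph with vertex set $\mathbb F_q^m$, in which two distinct vectors $v,w$ are adjacent if and only if $v-w$ is a scalar multiple of some $g_i$, is a connected strongly regular graph with the parameters $(N,K,\lambda,\mu)$ above. -/

import Mathlib

/-- The defining set `D = {x ∈ E^* : Tr_{L/F}(N_{E/L}(x)) + a = 0}` for finite fields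
`F ⊆ L ⊆ E` (here `F = 𝔽_q`, `L = 𝔽_{q^{m₂}}`, `E = 𝔽_{q^m}`) and `a ∈ F`. -/
def definingSet (F L E : Type*) [Field F] [Field L] [Field E] [Algebra F L] [Algebra L E]
    (a : F) : Set E :=
  {x : E | x ≠ 0 ∧ Algebra.trace F L (Algebra.norm L x) + a = 0}

/-- `d₁, …, dₙ` is a shortened defining set of `D`: one has
`D = F^* · {d₁, …, dₙ}`, and `dᵢ / dⱼ ∉ F^*` for all `i ≠ j`. -/
def IsShortenedDefiningSet (F : Type*) {E : Type*} [Field F] [Field E] [Algebra F E]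
    (D : Set E) {n : ℕ} (d : Fin n → E) : Prop :=
  D = {x : E | ∃ (u : F) (i : Fin n), u ≠ 0 ∧ x = algebraMap F E u * d i} ∧
    ∀ i j : Fin n, i ≠ j → ∀ u : F, u ≠ 0 → d i / d j ≠ algebraMap F E u

/-- The linear code
`{(Tr_{L/F}(x N_{E/L}(d₁)), …, Tr_{L/F}(x N_{E/L}(dₙ))) : x ∈ L}` of length `n` over `F`
(here `L = 𝔽_{q^{m₁}}` and `E = 𝔽_{q^m}`). -/
noncomputable def traceNormCode (F L : Type*) {E : Type*} [Field F] [Field L] [Field E]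
    [Algebra F L] [Algebra L E] {n : ℕ} (d : Fin n → E) : Submodule F (Fin n → F) :=
  LinearMap.range (LinearMap.pi fun i : Fin n =>
    Algebra.trace F L ∘ₗ LinearMap.mulRight F (Algebra.norm L (d i)))

open scoped Classical in
/-- A linear code is projective if the minimum distance of its dual code is at least `3`. -/
def IsProjectiveCode {F : Type*} [Field F] {n : ℕ} (C : Submodule F (Fin n → F)) : Prop :=
  ∀ y : Fin n → F, (∀ c ∈ C, ∑ i, c i * y i = 0) → y ≠ 0 → 3 ≤ hammingNorm y

open scoped Classical in
/-- A linear code is a two-weight code if its nonzero codewords have exactly two distinct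
Hamming weights. -/
def IsTwoWeightCode {F : Type*} [Field F] {n : ℕ} (C : Submodule F (Fin n → F)) : Prop :=
  ∃ w₁ w₂ : ℕ, w₁ ≠ w₂ ∧ {w : ℕ | ∃ c ∈ C, c ≠ 0 ∧ hammingNorm c = w} = {w₁, w₂}

/-- The `i`-th coordinate functional of a code. With respect to a basis of `C`, that is, a
generator matrix, it is the `i`-th column of that matrix. -/
def codeColumn {F : Type*} [Field F] {n : ℕ} (C : Submodule F (Fin n → F)) (i : Fin n) :
    Module.Dual F C :=
  LinearMap.proj i ∘ₗ C.subtype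

/-- The graph of a linear `[n, k]` code over `F`, written without a choice of basis. In terms of
a generator matrix with columns `g₁, …, gₙ ∈ F^k`, its vertices are the vectors of `F^k`, and
distinct `v, w` are joined when `v - w` is a scalar multiple of some `gᵢ`. -/
def codeGraph {F : Type*} [Field F] {n : ℕ} (C : Submodule F (Fin n → F)) :
    SimpleGraph (Module.Dual F C) where
  Adj v w := v ≠ w ∧ ∃ (u : F) (i : Fin n), v - w = u • codeColumn C i
  symm := ⟨by
    rintro v w ⟨h, u, i, hu⟩
    exact ⟨h.symm, -u, i, by
      rw [← neg_sub v w, hu]; exact (neg_smul u (codeColumn C i)).symm⟩⟩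
  loopless := ⟨fun _ h => h.1 rfl⟩

/-- A (finite) connected graph on `N` vertices that is regular of valency `K` and in which two
distinct vertices have `l` or `μ` common neighbours according as they are adjacent or not. -/
def IsConnectedSRG {V : Type*} (G : SimpleGraph V) (N K l μ : ℕ) : Prop :=
  G.Connected ∧ ∃ (_ : Fintype V) (_ : DecidableRel G.Adj), G.IsSRGWith N K l μ

/-! ### Roots in a finite field, and Fourier inversion for difference counts -/

section

open Finset

/-! Put M = (q^m - 1)/(q^2 - 1). Since the trace of y from F_{q^2} to F_q is y + y^q, the defining
set D consists of the x with x^((q-1)M) = -1, so it is a coset of the group of (q+1)-th powers in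
E^* (`mem_definingSet_zero_iff`). For g in D, the character sum of D at a is therefore (S(ga) -
1)/(q+1), where S(a) is the sum of ψ(Tr(a y^(q+1))) over all y (`hermitianSum_mul_eq`). As D is also
F^*-stable, the same character sum equals (q-1)n - q·wt, with wt the weight of the codeword of a; in
particular it is an integer (`sum_traceChar_of_isShortenedDefiningSet`).

For all a ≠ 0 outside one coset of the (q+1)-th powers, S(a)S(-a) = q^m, and S(-a) = S(a), so S(a) =
±q^(m/2); the congruence S(a) ≡ 1 mod q+1 fixes the sign. On the exceptional coset S is constant,
and its value follows from the total of S over E, which is q^m. So there are two weights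
(`weight_dichotomy`), and the indicator of D has two Fourier coefficients away from 0. Fourier
inversion turns these into the difference counts λ and μ (`card_difference_eq`). Finally the trace
form carries each dᵢ to the i-th column of the code, so that the code graph is the Cayley graph of E
with connection set D (`codeGraph_adj_iff`). -/

theorem card_pow_eq_of_mul_eq_card {E : Type*} [Field E] [Fintype E] [DecidableEq E] {a b : ℕ}
    (hab : a * b = Fintype.card E - 1) {c : E} (hc : c ^ b = 1) :
    #{x : E | x ^ a = c} = a := by
  have hpos : 0 < a * b := by
    rw [hab]; exact Nat.sub_pos_of_lt Fintype.one_lt_card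
  have ha : 0 < a := Nat.pos_of_mul_pos_right hpos
  have hb : 0 < b := Nat.pos_of_mul_pos_left hpos
  obtain ⟨g, hg⟩ := IsCyclic.exists_generator (α := Eˣ)
  have hord : orderOf g = a * b := by
    rw [orderOf_eq_card_of_forall_mem_zpowers hg, Nat.card_eq_fintype_card, Fintype.card_units,
      hab]
  have hζ : IsPrimitiveRoot (g : E) (a * b) := by
    rw [← hord]; exact IsPrimitiveRoot.coe_units_iff.mpr (IsPrimitiveRoot.orderOf g)
  have : NeZero (a * b) := ⟨hpos.ne'⟩
  obtain ⟨i, -, rfl⟩ := hζ.eq_pow_of_pow_eq_one (ξ := c) (by rw [mul_comm, pow_mul, hc, one_pow])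
  rw [← pow_mul, hζ.pow_eq_one_iff_dvd] at hc
  -- From c = g^i and c^b = 1, a divides i, so c is an a-th power; the a-th roots of unity,
  -- generated by g^b, then supply exactly a roots.
  obtain ⟨j, rfl⟩ := Nat.dvd_of_mul_dvd_mul_right hb hc
  have hζa : IsPrimitiveRoot ((g : E) ^ b) a := hζ.pow hpos (mul_comm a b)
  have hne : ((g : E) ^ (a * j)) ≠ 0 := pow_ne_zero _ g.ne_zero
  rw [← Nat.cast_id #_]
  have h1 := hζa.card_nthRoots ((g : E) ^ (a * j))
  rw [if_pos ⟨(g : E) ^ j, by rw [← pow_mul, mul_comm]⟩] at h1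
  rw [← Multiset.toFinset_card_of_nodup (hζa.nthRoots_nodup hne)] at h1
  rw [Nat.cast_id, ← h1, h1]
  conv_rhs => rw [← h1]
  congr 1
  ext x
  simp [Polynomial.mem_nthRoots ha]

theorem exists_pow_eq_of_mul_eq_card {E : Type*} [Field E] [Fintype E] {a b : ℕ}
    (hab : a * b = Fintype.card E - 1) {c : E} (hc : c ^ b = 1) : ∃ x : E, x ^ a = c := by
  classical
  have h := card_pow_eq_of_mul_eq_card hab hc
  have hpos : 0 < a * b := by
    rw [hab]; exact Nat.sub_pos_of_lt Fintype.one_lt_card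
  obtain ⟨x, hx⟩ := card_pos.1 (h.symm ▸ Nat.pos_of_mul_pos_right hpos :
    0 < #{x : E | x ^ a = c})
  exact ⟨x, by simpa using hx⟩

/-- A set with a two-valued Fourier transform has a two-valued difference function. -/
theorem card_mul_card_filter_sub_mem {E : Type*} [Field E] [Fintype E] [DecidableEq E]
    {ψ : AddChar E ℂ} (hψ : ψ.IsPrimitive) (D : Finset E) (s p : ℂ)
    (h : ∀ a : E, a ≠ 0 → (∑ x ∈ D, ψ (a * x)) ^ 2 = s * (∑ x ∈ D, ψ (a * x)) - p) (c : E) :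
    (Fintype.card E : ℂ) * #{x ∈ D | c - x ∈ D} =
      (#D : ℂ) ^ 2 - s * #D + p +
        Fintype.card E * ((if c ∈ D then s else 0) - if c = 0 then p else 0) := by
  have hsum : ∀ b : E, ∑ a : E, ψ (a * b) = if b = 0 then (Fintype.card E : ℂ) else 0 :=
    fun b => by rw [AddChar.sum_mulShift b hψ]; split_ifs <;> simp
  -- Both sides of the quadratic relation are inverted at c. The square of the transform belongs to
  -- the convolution of the indicator of D with itself.
  have e1 : ∑ a : E, (∑ x ∈ D, ψ (a * x)) ^ 2 * ψ (a * -c) =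
      (Fintype.card E : ℂ) * #{x ∈ D | c - x ∈ D} := by
    calc _ = ∑ x ∈ D, ∑ y ∈ D, ∑ a : E, ψ (a * (x + y - c)) := by
          simp_rw [sq, sum_mul_sum, sum_mul]
          rw [sum_comm]
          refine sum_congr rfl fun x _ => ?_
          rw [sum_comm]
          refine sum_congr rfl fun y _ => sum_congr rfl fun a _ => ?_
          rw [← AddChar.map_add_eq_mul, ← AddChar.map_add_eq_mul]
          congr 1; ring
      _ = ∑ x ∈ D, if c - x ∈ D then (Fintype.card E : ℂ) else 0 := by
          refine sum_congr rfl fun x _ => ?_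
          simp_rw [hsum]
          rw [← sum_ite_eq' D (c - x) fun _ => (Fintype.card E : ℂ)]
          refine sum_congr rfl fun y _ => ?_
          congr 1
          rw [eq_sub_iff_add_eq', sub_eq_zero]
      _ = _ := by
          rw [← sum_filter, sum_const, nsmul_eq_mul, mul_comm]
  have e2 : ∑ a : E, (s * (∑ x ∈ D, ψ (a * x)) - p) * ψ (a * -c) =
      Fintype.card E * ((if c ∈ D then s else 0) - if c = 0 then p else 0) := by
    simp_rw [sub_mul, sum_sub_distrib, mul_assoc, ← mul_sum, hsum, neg_eq_zero, sum_mul]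
    rw [sum_comm]
    simp_rw [← AddChar.map_add_eq_mul, ← mul_add, hsum]
    simp_rw [← sub_eq_add_neg, sub_eq_zero, sum_ite_eq']
    split_ifs <;> ring
  -- The relation is assumed only for a ≠ 0, so the two inversions differ by the term a = 0, where
  -- the transform is `#D`.
  rw [← e1, ← e2, ← sub_eq_iff_eq_add, ← sum_sub_distrib,
    sum_eq_single_of_mem 0 (mem_univ _)]
  · simp; ring
  · intro a _ ha
    rw [h a ha, sub_self]

/-! ### The defining set as a coset of the (q+1)-th powers -/

theorem neg_one_pow_card (F : Type*) {E : Type*} [Field F] [Fintype F] [Field E] [Algebra F E] :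
    (-1 : E) ^ Fintype.card F = -1 := by
  have h := congrArg (algebraMap F E) (FiniteField.pow_card (-1 : F))
  simpa using h

/-- The norm to L is x^M, and for y ≠ 0 in L the trace y + y^q = y(1 + y^(q-1)) vanishes exactly
when y^(q-1) = -1. -/
theorem mem_definingSet_zero_iff {F L E : Type*} [Field F] [Field L] [Field E] [Algebra F L]
    [Algebra L E] [Fintype F] [Finite L] [Fintype E] (hL : Module.finrank F L = 2) {M : ℕ}
    (hM : (Fintype.card F - 1) * M * (Fintype.card F + 1) = Fintype.card E - 1) (x : E) :
    x ∈ definingSet F L E 0 ↔ x ^ ((Fintype.card F - 1) * M) = -1 := by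
  set q := Fintype.card F with hq
  have hq1 : 1 < q := Fintype.one_lt_card
  have hE1 : 1 < Fintype.card E := Fintype.one_lt_card
  have hLc : Nat.card L = q ^ 2 := by
    rw [Module.natCard_eq_pow_finrank (K := F), hL, Nat.card_eq_fintype_card]
  have hN : algebraMap L E (Algebra.norm L x) = x ^ M := by
    rw [FiniteField.algebraMap_norm_eq_pow, hLc, Nat.card_eq_fintype_card, ← hM]
    congr 1
    have : q ^ 2 - 1 = (q + 1) * (q - 1) := by simpa using Nat.sq_sub_sq q 1
    rw [this]
    apply Nat.div_eq_of_eq_mul_left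
    · exact Nat.mul_pos (by omega) (by omega)
    · ring
  set y := Algebra.norm L x with hy
  have hT : Algebra.trace F L y = 0 ↔ y + y ^ q = 0 := by
    rw [← map_eq_zero (algebraMap F L), FiniteField.algebraMap_trace_eq_sum_pow, hL,
      sum_range_succ, sum_range_one, Nat.card_eq_fintype_card, pow_zero, pow_one, pow_one]
  have hK : x ^ ((q - 1) * M) = algebraMap L E (y ^ (q - 1)) := by
    rw [map_pow, hN, ← pow_mul, mul_comm]
  have hexp : (q - 1) * M ≠ 0 := by
    intro h; rw [h, zero_mul] at hM; omega
  have hsplit : y + y ^ q = y * (y ^ (q - 1) + 1) := by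
    rw [mul_add, mul_one, ← pow_succ', Nat.sub_add_cancel hq1.le, add_comm]
  simp only [definingSet, Set.mem_ofPred_eq, add_zero]
  rw [← hy, hT, hsplit, hK, ← map_one (algebraMap L E), ← map_neg,
    (algebraMap L E).injective.eq_iff, ← add_eq_zero_iff_eq_neg, mul_eq_zero]
  constructor
  · rintro ⟨h0, h | h⟩
    · exact absurd (Algebra.norm_eq_zero_iff.1 h) h0
    · exact h
  · refine fun h => ⟨?_, Or.inr h⟩
    rintro rfl
    rw [hy, Algebra.norm_zero, zero_pow (by omega)] at h
    simp at h

/-- The additive character `x ↦ ψ (Tr x)` of an extension field. -/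
noncomputable def traceChar {F : Type*} (E : Type*) [Field F] [Field E] [Algebra F E]
    (ψ : AddChar F ℂ) : AddChar E ℂ :=
  ψ.compAddMonoidHom (Algebra.trace F E).toAddMonoidHom

theorem traceChar_apply {F E : Type*} [Field F] [Field E] [Algebra F E] (ψ : AddChar F ℂ) (x : E) :
    traceChar E ψ x = ψ (Algebra.trace F E x) := rfl

theorem add_pow_card_field {F E : Type*} [Field F] [Fintype F] [Field E] [Algebra F E]
    (x y : E) : (x + y) ^ Fintype.card F =
    x ^ Fintype.card F + y ^ Fintype.card F :=
  map_add (FiniteField.frobeniusAlgHom F E) x y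

/-! ### Trace characters and Hermitian sums -/

section traceChar

variable {F E : Type*} [Field F] [Fintype F] [Field E] [Fintype E] [Algebra F E]

theorem isPrimitive_traceChar {ψ : AddChar F ℂ} (hψ : ψ.IsPrimitive) :
    (traceChar E ψ).IsPrimitive := by
  apply AddChar.IsPrimitive.of_ne_one
  have h1 : ψ ≠ 1 := by simpa using hψ one_ne_zero
  obtain ⟨a, ha⟩ := AddChar.ne_one_iff.1 h1
  obtain ⟨b, rfl⟩ := Algebra.trace_surjective F E a
  exact AddChar.ne_one_iff.2 ⟨b, ha⟩

theorem traceChar_pow_card (ψ : AddChar F ℂ) (x : E) :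
    traceChar E ψ (x ^ Fintype.card F) = traceChar E ψ x := by
  rw [traceChar_apply, traceChar_apply,
    ← Algebra.trace_eq_of_algEquiv (FiniteField.frobeniusAlgEquivOfAlgebraic F E) x]
  simp

theorem pow_card_field_bijective : Function.Bijective fun x : E => x ^ Fintype.card F :=
  (FiniteField.frobeniusAlgEquivOfAlgebraic F E).bijective

/-- The Hermitian-type exponential sum `∑ y, ψ (a y ^ (q + 1))`. -/
noncomputable def hermitianSum (ψ : AddChar F ℂ) (a : E) : ℂ :=
  ∑ y : E, traceChar E ψ (a * y ^ (Fintype.card F + 1))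

theorem sum_traceChar_mul {ψ : AddChar F ℂ} (hψ : ψ.IsPrimitive) [DecidableEq E] (b : E) :
    ∑ x : E, traceChar E ψ (b * x) = if b = 0 then (Fintype.card E : ℂ) else 0 := by
  simp_rw [mul_comm b]
  rw [AddChar.sum_mulShift b (isPrimitive_traceChar hψ)]; split_ifs <;> simp

theorem sum_traceChar_mul_pow_card {ψ : AddChar F ℂ} (hψ : ψ.IsPrimitive) [DecidableEq E] (b : E) :
    ∑ x : E, traceChar E ψ (b * x ^ Fintype.card F) =
      if b = 0 then (Fintype.card E : ℂ) else 0 := by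
  rw [← sum_traceChar_mul hψ]
  exact Fintype.sum_bijective _ (pow_card_field_bijective (F := F)) _ _ fun _ => rfl

/-- Weil's differencing: with y = z + t the terms of degree q+1 in z cancel and what remains is
additive in z. Summing over z leaves only the kernel of t ↦ at + a^q t^(q²), which the condition on
a makes trivial. -/
theorem hermitianSum_mul_hermitianSum_neg {ψ : AddChar F ℂ} (hψ : ψ.IsPrimitive) {M : ℕ}
    (hM : (Fintype.card F - 1) * M * (Fintype.card F + 1) = Fintype.card E - 1) {a : E}
    (ha : a ≠ 0) (haM : a ^ ((Fintype.card F - 1) * M) ≠ (-1) ^ M) :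
    hermitianSum ψ a * hermitianSum ψ (-a) = Fintype.card E := by
  classical
  set q := Fintype.card F with hq
  have hq1 : 1 < q := Fintype.one_lt_card
  have key : ∀ t : E, a * t + a ^ q * t ^ (q * q) = 0 ↔ t = 0 := by
    refine fun t => ⟨fun h => ?_, ?_⟩
    · by_contra ht
      apply haM
      have h1 : a * t * (1 + a ^ (q - 1) * t ^ ((q - 1) * (q + 1))) = 0 := by
        obtain ⟨r, hr⟩ := Nat.exists_eq_add_of_lt hq1
        have e1 : q - 1 = r + 1 := by omega
        rw [e1]; rw [← h, hr]; ring
      have h2 : a ^ (q - 1) * t ^ ((q - 1) * (q + 1)) = -1 := by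
        have := (mul_eq_zero.1 h1).resolve_left (mul_ne_zero ha ht)
        linear_combination this
      -- Raising to the M-th power removes t, because (q-1)(q+1)M = |E| - 1.
      have h3 := congrArg (· ^ M) h2
      simp only [mul_pow, ← pow_mul] at h3
      have e2 : (q - 1) * (q + 1) * M = Fintype.card E - 1 := by rw [← hM]; ring
      rw [e2, FiniteField.pow_card_sub_one_eq_one t ht, mul_one] at h3
      exact h3
    · rintro rfl
      have : q * q ≠ 0 := by positivity
      simp [this]
  -- Frobenius invariance of the trace replaces a t^q z by its q-th power, so both cross terms
  -- become multiples of z^q.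
  have step : ∀ z t : E, traceChar E ψ (a * (z + t) ^ (q + 1)) *
      traceChar E ψ (-a * z ^ (q + 1)) =
      traceChar E ψ (a * t ^ (q + 1)) *
        traceChar E ψ ((a * t + a ^ q * t ^ (q * q)) * z ^ q) := by
    intro z t
    have e1 : a * (z + t) ^ (q + 1) + -a * z ^ (q + 1) =
        a * t ^ (q + 1) + (a * t * z ^ q + a * t ^ q * z) := by
      rw [pow_succ, add_pow_card_field]; ring
    have e2 : (a * t + a ^ q * t ^ (q * q)) * z ^ q = a * t * z ^ q + (a * t ^ q * z) ^ q := by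
      rw [mul_pow, mul_pow, ← pow_mul]; ring
    rw [← AddChar.map_add_eq_mul, e1, e2, AddChar.map_add_eq_mul, AddChar.map_add_eq_mul,
      AddChar.map_add_eq_mul, traceChar_pow_card]
  calc hermitianSum ψ a * hermitianSum ψ (-a)
      = ∑ z : E, ∑ t : E, traceChar E ψ (a * (z + t) ^ (q + 1)) *
          traceChar E ψ (-a * z ^ (q + 1)) := by
        rw [hermitianSum, hermitianSum, sum_mul_sum, sum_comm]
        exact sum_congr rfl fun z _ => (Equiv.sum_comp (Equiv.addLeft z)
          (fun y => traceChar E ψ (a * y ^ (q + 1)) * traceChar E ψ (-a * z ^ (q + 1)))).symm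
    _ = ∑ t : E, traceChar E ψ (a * t ^ (q + 1)) *
          if t = 0 then (Fintype.card E : ℂ) else 0 := by
        simp_rw [step]
        rw [sum_comm]
        refine sum_congr rfl fun t _ => ?_
        rw [← mul_sum, sum_traceChar_mul_pow_card hψ]
        simp_rw [key]
    _ = Fintype.card E := by simp

theorem hermitianSum_mul_pow (ψ : AddChar F ℂ) (a : E) {v : E} (hv : v ≠ 0) :
    hermitianSum ψ (a * v ^ (Fintype.card F + 1)) = hermitianSum ψ a := by
  refine Fintype.sum_equiv (Equiv.mulLeft₀ v hv) _ _ fun y => ?_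
  simp [mul_pow, mul_assoc]

theorem sum_hermitianSum {ψ : AddChar F ℂ} (hψ : ψ.IsPrimitive) :
    ∑ a : E, hermitianSum ψ a = Fintype.card E := by
  classical
  simp_rw [hermitianSum]
  rw [sum_comm]
  simp_rw [mul_comm _ (_ ^ _), sum_traceChar_mul hψ]
  simp

end traceChar

/-! ### Evaluation of the Hermitian sums -/

section

variable {F E : Type*} [Field F] [Fintype F] [Field E] [Fintype E] [Algebra F E]

theorem neg_one_pow_card_sub_one_mul (F : Type*) {E : Type*} [Field F] [Fintype F] [Field E]
    [Algebra F E] (M : ℕ) : (-1 : E) ^ ((Fintype.card F - 1) * M) = 1 := by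
  have h := neg_one_pow_card F (E := E)
  rw [← Nat.sub_add_cancel (Fintype.one_lt_card (α := F)).le, pow_succ] at h
  rw [pow_mul, show (-1 : E) ^ (Fintype.card F - 1) = 1 by linear_combination -h, one_pow]

theorem neg_one_pow_card_add_one (F : Type*) {E : Type*} [Field F] [Fintype F] [Field E]
    [Algebra F E] : (-1 : E) ^ (Fintype.card F + 1) = 1 := by
  rw [pow_succ, neg_one_pow_card F]; simp

/-- -1 is a (q+1)-th power in E, since (-1)^((q-1)M) = 1. -/
theorem hermitianSum_neg (ψ : AddChar F ℂ) {M : ℕ}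
    (hM : (Fintype.card F - 1) * M * (Fintype.card F + 1) = Fintype.card E - 1) (a : E) :
    hermitianSum ψ (-a) = hermitianSum ψ a := by
  obtain ⟨v, hv⟩ := exists_pow_eq_of_mul_eq_card (E := E) ((mul_comm _ _).trans hM)
    (neg_one_pow_card_sub_one_mul F M)
  have hv0 : v ≠ 0 := by
    rintro rfl
    simp at hv
  rw [← hermitianSum_mul_pow ψ a hv0, hv, mul_neg_one]

theorem hermitianSum_of_pow_ne {ψ : AddChar F ℂ} (hψ : ψ.IsPrimitive) {M k : ℕ}
    (hM : (Fintype.card F - 1) * M * (Fintype.card F + 1) = Fintype.card E - 1)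
    (hk : Fintype.card E = Fintype.card F ^ (2 * k))
    (hint : ∀ a : E, ∃ z : ℤ, hermitianSum ψ a = 1 + (Fintype.card F + 1) * z) {a : E}
    (ha : a ≠ 0) (haM : a ^ ((Fintype.card F - 1) * M) ≠ (-1) ^ M) :
    hermitianSum ψ a = (-1) ^ k * Fintype.card F ^ k := by
  have h := hermitianSum_mul_hermitianSum_neg hψ hM ha haM
  rw [hermitianSum_neg ψ hM] at h
  obtain ⟨z, hz⟩ := hint a
  have hq1 : 1 < Fintype.card F := Fintype.one_lt_card
  set q := Fintype.card F with hq
  have hsq : (1 + ((q : ℤ) + 1) * z) ^ 2 = ((-1) ^ k * (q : ℤ) ^ k) ^ 2 := by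
    have : ((1 + ((q : ℂ) + 1) * z)) ^ 2 = ((-1) ^ k * (q : ℂ) ^ k) ^ 2 := by
      rw [← hz, sq, h, hk, mul_pow, ← pow_mul, mul_comm k 2, pow_mul (-1 : ℂ), neg_one_sq,
        one_pow, one_mul, ← pow_mul, mul_comm k 2]
      push_cast; rfl
    exact_mod_cast this
  -- (-q)^k ≡ 1 mod q+1. The opposite sign would then force q+1 to divide 2, which is impossible as
  -- q ≥ 2.
  have hmod : (q : ℤ) + 1 ∣ (-1) ^ k * (q : ℤ) ^ k - 1 := by
    have := sub_dvd_pow_sub_pow (-(q : ℤ)) 1 k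
    rw [one_pow, ← neg_one_mul (q : ℤ), mul_pow] at this
    refine (Dvd.intro (-1) ?_).trans this
    ring
  have hres : 1 + ((q : ℤ) + 1) * z = (-1) ^ k * (q : ℤ) ^ k := by
    rcases sq_eq_sq_iff_eq_or_eq_neg.1 hsq with h | h
    · exact h
    · exfalso
      have h2 : (q : ℤ) + 1 ∣ 2 := by
        have h3 : (2 : ℤ) = -(((-1) ^ k * (q : ℤ) ^ k - 1) + ((q : ℤ) + 1) * z) := by linarith
        rw [h3]
        exact (dvd_add hmod (dvd_mul_right _ _)).neg_right
      have := Int.le_of_dvd (by norm_num) h2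
      omega
  rw [hz]
  exact_mod_cast hres

/-- The exceptional a form one coset of the (q+1)-th powers, on which the sum is constant. All other
values are known, so the total over E determines this one. -/
theorem hermitianSum_of_pow_eq {ψ : AddChar F ℂ} (hψ : ψ.IsPrimitive) {M k : ℕ}
    (hM : (Fintype.card F - 1) * M * (Fintype.card F + 1) = Fintype.card E - 1)
    (hk : Fintype.card E = Fintype.card F ^ (2 * k))
    (hint : ∀ a : E, ∃ z : ℤ, hermitianSum ψ a = 1 + (Fintype.card F + 1) * z) {a : E}
    (haM : a ^ ((Fintype.card F - 1) * M) = (-1) ^ M) :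
    hermitianSum ψ a = -((-1) ^ k * Fintype.card F ^ (k + 1)) := by
  classical
  set q := Fintype.card F with hq
  have hq1 : 1 < q := Fintype.one_lt_card
  set K := (q - 1) * M with hK
  have hE1 : 1 < Fintype.card E := Fintype.one_lt_card
  have hK0 : K ≠ 0 := by
    intro h; rw [h, zero_mul] at hM; omega
  have ha0 : a ≠ 0 := by
    rintro rfl
    rw [zero_pow hK0] at haM
    exact pow_ne_zero _ (neg_ne_zero.2 one_ne_zero) haM.symm
  set A : Finset E := {x | x ^ K = (-1) ^ M} with hA
  have hAcard : #A = K := card_pow_eq_of_mul_eq_card hM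
    (by rw [← pow_mul, mul_comm, pow_mul, neg_one_pow_card_add_one F, one_pow])
  have hconst : ∀ x ∈ A, hermitianSum ψ x = hermitianSum ψ a := by
    intro x hx
    have hx' : x ^ K = (-1) ^ M := by simpa [hA] using hx
    obtain ⟨v, hv⟩ := exists_pow_eq_of_mul_eq_card (E := E) ((mul_comm _ _).trans hM)
      (c := x / a) (by rw [div_pow, hx', haM, div_self (by simp)])
    have hxa : x = a * v ^ (q + 1) := by rw [hv, mul_div_cancel₀ _ ha0]
    have hv0 : v ≠ 0 := by
      rintro rfl
      rw [zero_pow (by omega), mul_zero] at hxa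
      rw [hxa, zero_pow hK0] at hx'
      exact pow_ne_zero _ (neg_ne_zero.2 one_ne_zero) hx'.symm
    rw [hxa, hermitianSum_mul_pow ψ a hv0]
  have h0A : (0 : E) ∉ A := by
    simp only [hA, mem_filter, mem_univ, true_and, zero_pow hK0]
    exact fun h => pow_ne_zero M (neg_ne_zero.2 one_ne_zero) h.symm
  have hz : hermitianSum ψ (0 : E) = Fintype.card E := by simp [hermitianSum]
  have htot : ∑ x ∈ A, hermitianSum ψ x + ∑ x ∈ (univ \ insert 0 A), hermitianSum ψ x = 0 := by
    have := sum_hermitianSum hψ (E := E)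
    rw [← sum_sdiff (subset_univ (insert 0 A)), sum_insert h0A, hz] at this
    linear_combination this
  have hother : ∀ x ∈ univ \ insert 0 A, hermitianSum ψ x = (-1) ^ k * (q : ℂ) ^ k := by
    intro x hx
    simp only [mem_sdiff, mem_univ, mem_insert, true_and, not_or, hA, mem_filter] at hx
    exact hermitianSum_of_pow_ne hψ hM hk hint hx.1 hx.2
  rw [sum_congr rfl hconst, sum_congr rfl hother, sum_const, sum_const,
    card_sdiff_of_subset (subset_univ _), card_insert_of_notMem h0A, hAcard, card_univ] at htot
  -- Of the q+1 cosets, each of size K, all but the exceptional one remain.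
  have hcount : Fintype.card E - (K + 1) = K * q := by
    have : K * (q + 1) = K * q + K := by ring
    omega
  rw [hcount, nsmul_eq_mul, nsmul_eq_mul] at htot
  have hKC : (K : ℂ) ≠ 0 := Nat.cast_ne_zero.2 hK0
  apply mul_left_cancel₀ hKC
  push_cast at htot
  linear_combination htot

/-- Apart from y = 0, which contributes 1, the map y ↦ g y^(q+1) is (q+1)-to-one onto the coset of
g. -/
theorem hermitianSum_mul_eq [DecidableEq E] (ψ : AddChar F ℂ) {M : ℕ}
    (hM : (Fintype.card F - 1) * M * (Fintype.card F + 1) = Fintype.card E - 1) {g c : E}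
    (hc : c ≠ 0) (hg : g ^ ((Fintype.card F - 1) * M) = c) (a : E) :
    hermitianSum ψ (g * a) = 1 + (Fintype.card F + 1) *
      ∑ x : E with x ^ ((Fintype.card F - 1) * M) = c, traceChar E ψ (a * x) := by
  set q := Fintype.card F with hq
  set K := (q - 1) * M with hK
  have hE1 : 1 < Fintype.card E := Fintype.one_lt_card
  have hK0 : K ≠ 0 := by
    intro h; rw [h, zero_mul] at hM; omega
  have hg0 : g ≠ 0 := by
    rintro rfl
    rw [zero_pow hK0] at hg
    exact hc hg.symm
  rw [hermitianSum, ← add_sum_erase _ _ (mem_univ (0 : E))]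
  congr 1
  · simp
  rw [mul_sum, ← sum_fiberwise_of_maps_to (g := fun y => g * y ^ (q + 1))
    (t := {x : E | x ^ K = c})]
  · refine sum_congr rfl fun x hx => ?_
    have hx' : x ^ K = c := by simpa using hx
    have hfib : ({y ∈ univ.erase (0 : E) | g * y ^ (q + 1) = x} : Finset E) =
        ({y | y ^ (q + 1) = x / g} : Finset E) := by
      ext y
      simp only [mem_filter, mem_erase, mem_univ, and_true, true_and, ne_eq, eq_div_iff hg0]
      constructor
      · rintro ⟨-, h⟩
        rw [mul_comm, h]
      · rintro h
        refine ⟨?_, by rw [mul_comm, h]⟩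
        rintro rfl
        rw [zero_pow (by omega), zero_mul] at h
        rw [← h, zero_pow hK0] at hx'
        exact hc hx'.symm
    rw [hfib, sum_congr rfl (g := fun _ => traceChar E ψ (a * x)), sum_const,
      card_pow_eq_of_mul_eq_card (b := K) ((mul_comm _ _).trans hM), nsmul_eq_mul]
    · push_cast; rfl
    · rw [div_pow, hx', hg, div_self hc]
    · intro y hy
      have hy' : y ^ (q + 1) = x / g := by simpa using hy
      rw [hy']
      congr 1
      field_simp
  · intro y hy
    have hy0 : y ≠ 0 := by simpa using hy
    simp only [mem_filter, mem_univ, true_and]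
    rw [mul_pow, hg, ← pow_mul, mul_comm (q + 1), hM, FiniteField.pow_card_sub_one_eq_one y hy0,
      mul_one]

end

/-! ### Shortened defining sets -/

/-- D is in bijection with F^* × {dᵢ}. For each i, the sum of ψ(ut) over u ≠ 0, with t = Tr(a dᵢ),
is q - 1 if t = 0 and -1 otherwise. -/
theorem sum_traceChar_of_isShortenedDefiningSet {F E : Type*} [Field F] [Fintype F] [DecidableEq F]
    [Field E] [Algebra F E] {ψ : AddChar F ℂ}
    (hψ : ψ.IsPrimitive) {D : Finset E} (h0 : (0 : E) ∉ D) {n : ℕ} {d : Fin n → E}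
    (hd : IsShortenedDefiningSet F (D : Set E) d) (a : E) :
    ∑ x ∈ D, traceChar E ψ (a * x) = (Fintype.card F - 1) * n -
      Fintype.card F * #{i | Algebra.trace F E (a * d i) ≠ 0} := by
  obtain ⟨hD, hdiv⟩ := hd
  have hmem : ∀ x, x ∈ D ↔ ∃ (u : F) (i : Fin n), u ≠ 0 ∧ x = algebraMap F E u * d i := by
    intro x; rw [← mem_coe, hD]; rfl
  have hd0 : ∀ i, d i ≠ 0 := fun i hi =>
    h0 ((hmem 0).2 ⟨1, i, one_ne_zero, by rw [hi, mul_zero]⟩)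
  have hsum : ∀ t : F, ∑ u ∈ univ.erase (0 : F), ψ (u * t) =
      (Fintype.card F - 1) - if t ≠ 0 then (Fintype.card F : ℂ) else 0 := by
    intro t
    rw [sum_erase_eq_sub (mem_univ _), AddChar.sum_mulShift t hψ]
    by_cases ht : t = 0 <;> simp [ht]
  calc ∑ x ∈ D, traceChar E ψ (a * x)
      = ∑ p ∈ univ.erase (0 : F) ×ˢ (univ : Finset (Fin n)),
          ψ (p.1 * Algebra.trace F E (a * d p.2)) := by
        symm
        refine sum_bij (fun p _ => algebraMap F E p.1 * d p.2) ?_ ?_ ?_ ?_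
        · rintro ⟨u, i⟩ h
          exact (hmem _).2 ⟨u, i, by simpa using h, rfl⟩
        · rintro ⟨u, i⟩ h ⟨v, j⟩ h' e
          have hu : u ≠ 0 := by simpa using h
          have hv : v ≠ 0 := by simpa using h'
          have hu' : algebraMap F E u ≠ 0 := by simpa using hu
          simp only at e
          have hij : i = j := by
            by_contra hij
            refine hdiv i j hij (v / u) (div_ne_zero hv hu) ?_
            rw [map_div₀, div_eq_div_iff (hd0 j) hu', ← e, mul_comm]
          subst hij
          have := mul_right_cancel₀ (hd0 i) e
          rw [(algebraMap F E).injective this]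
        · intro x hx
          obtain ⟨u, i, hu, rfl⟩ := (hmem x).1 hx
          exact ⟨(u, i), by simpa using hu, rfl⟩
        · rintro ⟨u, i⟩ -
          rw [traceChar_apply, mul_left_comm, ← Algebra.smul_def, map_smul, smul_eq_mul]
    _ = ∑ i : Fin n, ((Fintype.card F - 1) -
          if Algebra.trace F E (a * d i) ≠ 0 then (Fintype.card F : ℂ) else 0) := by
        rw [sum_product_right]
        exact sum_congr rfl fun i _ => hsum (Algebra.trace F E (a * d i))
    _ = _ := by
        rw [sum_sub_distrib, ← sum_filter, sum_const, sum_const, card_univ, Fintype.card_fin,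
          nsmul_eq_mul, nsmul_eq_mul, mul_comm, mul_comm (Fintype.card F : ℂ)]

theorem exists_isShortenedDefiningSet {F E : Type*} [Field F] [Field E] [Finite E] [Algebra F E]
    {D : Set E} (h0 : (0 : E) ∉ D)
    (hD : ∀ (u : F) (x : E), u ≠ 0 → x ∈ D → algebraMap F E u * x ∈ D) :
    ∃ (n : ℕ) (d : Fin n → E), IsShortenedDefiningSet F D d := by
  let s : Setoid E := MulAction.orbitRel Fˣ E
  have hs : ∀ x y : E, s x y ↔ ∃ u : F, u ≠ 0 ∧ x = algebraMap F E u * y := by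
    intro x y
    constructor
    · rintro ⟨u, hu⟩
      exact ⟨u, u.ne_zero, by rw [← hu, ← Algebra.smul_def]; rfl⟩
    · rintro ⟨u, hu, rfl⟩
      exact ⟨Units.mk0 u hu, by rw [← Algebra.smul_def]; rfl⟩
  -- One representative for each F^*-orbit in D.
  let T : Set E := (fun x => (Quotient.mk s x).out) '' D
  obtain ⟨n, ⟨f⟩⟩ := Finite.exists_equiv_fin T
  have hout : ∀ x : E, s (Quotient.mk s x).out x := fun x => Quotient.mk_out x
  have hTD : ∀ t ∈ T, t ∈ D := by
    rintro _ ⟨x, hx, rfl⟩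
    obtain ⟨u, hu, h⟩ := (hs _ _).1 (hout x)
    simp only [h]
    exact hD u x hu hx
  refine ⟨n, fun i => f.symm i, ?_, ?_⟩
  · ext x
    constructor
    · intro hx
      obtain ⟨u, hu, h⟩ := (hs _ _).1 (s.symm (hout x))
      refine ⟨u, f ⟨(Quotient.mk s x).out, x, hx, rfl⟩, hu, ?_⟩
      exact h.trans (by simp only [Equiv.symm_apply_apply])
    · rintro ⟨u, i, hu, rfl⟩
      exact hD u _ hu (hTD _ (f.symm i).2)
  · intro i j hij u hu h
    apply hij
    apply f.symm.injective
    apply Subtype.ext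
    have hj0 : (f.symm j : E) ≠ 0 := fun h => h0 (h ▸ hTD _ (f.symm j).2)
    have hr : s (f.symm i : E) (f.symm j : E) := (hs _ _).2 ⟨u, hu, (div_eq_iff hj0).1 h⟩
    obtain ⟨x, -, hx⟩ := (f.symm i).2
    obtain ⟨y, -, hy⟩ := (f.symm j).2
    rw [← hx, ← hy] at hr ⊢
    have hxy : s x y := s.trans (s.symm (hout x)) (s.trans hr (hout y))
    simp only [Quotient.sound (s := s) hxy]

/-! ### Strongly regular Cayley graphs -/

/-- A graph that is a Cayley graph of a finite abelian group is strongly regular and connected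
if its connection set is a partial difference set with `μ > 0`. -/
theorem isConnectedSRG_of_adj_iff {V E : Type*} [AddCommGroup E] [Fintype E] [DecidableEq E]
    {G : SimpleGraph V} (e : E ≃ V) {D : Finset E}
    (hG : ∀ x y, G.Adj (e x) (e y) ↔ x - y ∈ D) {l μ : ℕ} (hμ : 0 < μ)
    (hl : ∀ c ∈ D, #{x ∈ D | c - x ∈ D} = l)
    (hm : ∀ c, c ≠ 0 → c ∉ D → #{x ∈ D | c - x ∈ D} = μ) :
    IsConnectedSRG G (Fintype.card E) #D l μ := by
  classical
  let _ : Fintype V := Fintype.ofEquiv _ e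
  have hinj : ∀ x, Function.Injective fun t => e (x - t) := fun x t t' h => by simpa using h
  have hcommon : ∀ x y, Fintype.card (G.commonNeighbors (e x) (e y)) =
      #{t ∈ D | x - y - t ∈ D} := by
    intro x y
    rw [← card_image_of_injective _ (hinj x)]
    refine Fintype.card_of_subtype _ fun z => ?_
    obtain ⟨z, rfl⟩ := e.surjective z
    -- Reversing the second edge gives z - y in place of y - z, so that the two differences add up
    -- to x - y.
    rw [SimpleGraph.mem_commonNeighbors, G.adj_comm (e y), hG, hG]
    simp only [mem_image, mem_filter, EmbeddingLike.apply_eq_iff_eq]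
    constructor
    · rintro ⟨t, ⟨h1, h2⟩, rfl⟩
      exact ⟨by simpa using h1, by convert h2 using 1; abel⟩
    · rintro ⟨h1, h2⟩
      exact ⟨x - z, ⟨h1, by convert h2 using 1; abel⟩, by abel⟩
  have hnot : ∀ x y, x ≠ y → ¬ G.Adj (e x) (e y) →
      Fintype.card (G.commonNeighbors (e x) (e y)) = μ := fun x y hxy h => by
    rw [hcommon]
    exact hm _ (sub_ne_zero.2 hxy) fun h' => h ((hG x y).2 h')
  refine ⟨(SimpleGraph.connected_iff G).2 ⟨?_, ⟨e 0⟩⟩, inferInstance, inferInstance,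
    ⟨?_, ?_, ?_, ?_⟩⟩
  · intro v w
    obtain ⟨x, rfl⟩ := e.surjective v
    obtain ⟨y, rfl⟩ := e.surjective w
    rcases eq_or_ne x y with rfl | hxy
    · rfl
    by_cases h : G.Adj (e x) (e y)
    · exact h.reachable
    · have hpos := hnot x y hxy h ▸ hμ
      obtain ⟨z, hz⟩ := Fintype.card_pos_iff.1 hpos
      rw [SimpleGraph.mem_commonNeighbors] at hz
      exact hz.1.reachable.trans hz.2.symm.reachable
  · exact (Fintype.card_congr e).symm
  · intro v
    obtain ⟨x, rfl⟩ := e.surjective v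
    rw [← SimpleGraph.card_neighborSet_eq_degree, ← card_image_of_injective _ (hinj x)]
    refine Fintype.card_of_subtype _ fun z => ?_
    obtain ⟨z, rfl⟩ := e.surjective z
    rw [SimpleGraph.mem_neighborSet, hG]
    simp only [mem_image, EmbeddingLike.apply_eq_iff_eq]
    constructor
    · rintro ⟨t, h1, rfl⟩
      simpa using h1
    · exact fun h => ⟨x - z, h, by abel⟩
  · intro v w h
    obtain ⟨x, rfl⟩ := e.surjective v
    obtain ⟨y, rfl⟩ := e.surjective w
    rw [hcommon]
    exact hl _ ((hG x y).1 h)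
  · intro v w hvw h
    obtain ⟨x, rfl⟩ := e.surjective v
    obtain ⟨y, rfl⟩ := e.surjective w
    exact hnot x y (fun h => hvw (h ▸ rfl)) h

theorem isConnectedSRG_congr {V W : Type*} {G : SimpleGraph V} {H : SimpleGraph W} (f : G ≃g H)
    {N K l μ : ℕ} (h : IsConnectedSRG G N K l μ) : IsConnectedSRG H N K l μ := by
  classical
  obtain ⟨hc, _, _, hs⟩ := h
  let _ : Fintype W := Fintype.ofEquiv _ f.toEquiv
  have hcommon : ∀ v w, Fintype.card (H.commonNeighbors v w) =
      Fintype.card (G.commonNeighbors (f.symm v) (f.symm w)) := by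
    intro v w
    refine Fintype.card_congr (f.symm.toEquiv.subtypeEquiv fun z => ?_)
    rw [SimpleGraph.mem_commonNeighbors, SimpleGraph.mem_commonNeighbors]
    exact and_congr f.symm.map_adj_iff.symm f.symm.map_adj_iff.symm
  refine ⟨f.connected_iff.1 hc, inferInstance, inferInstance, ⟨?_, ?_, ?_, ?_⟩⟩
  · rw [← hs.card]; exact (Fintype.card_congr f.toEquiv).symm
  · intro v
    rw [← hs.regular (f.symm v), ← SimpleGraph.card_neighborSet_eq_degree,
      ← SimpleGraph.card_neighborSet_eq_degree]
    exact Fintype.card_congr (f.symm.toEquiv.subtypeEquiv fun z => f.symm.map_adj_iff.symm)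
  · intro v w h
    rw [hcommon]
    convert hs.of_adj (f.symm v) (f.symm w) (f.symm.map_adj_iff.2 h)
  · intro v w hvw h
    rw [hcommon]
    convert hs.of_not_adj (f.symm.injective.ne hvw) (fun h' => h (f.symm.map_adj_iff.1 h'))

/-! ### Existence and counting lemmas -/

theorem exists_primitive_addChar (F : Type*) [Field F] [Fintype F] :
    ∃ ψ : AddChar F ℂ, ψ.IsPrimitive := by
  have h1 : (1 : F) ≠ 0 := one_ne_zero
  obtain ⟨ψ, hψ⟩ := AddChar.exists_apply_ne_zero.2 h1
  exact ⟨ψ, AddChar.IsPrimitive.of_ne_one (AddChar.ne_one_iff.2 ⟨1, hψ⟩)⟩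

theorem exponent_ne_zero {F E : Type*} [Fintype F] [Field E] [Fintype E] {M : ℕ}
    (hM : (Fintype.card F - 1) * M * (Fintype.card F + 1) = Fintype.card E - 1) :
    (Fintype.card F - 1) * M ≠ 0 := by
  have hE1 : 1 < Fintype.card E := Fintype.one_lt_card
  intro h; rw [h, zero_mul] at hM; omega

theorem zero_notMem_filter_pow {F E : Type*} [Fintype F] [Field E] [Fintype E]
    [DecidableEq E] {M : ℕ}
    (hM : (Fintype.card F - 1) * M * (Fintype.card F + 1) = Fintype.card E - 1) :
    (0 : E) ∉ ({x | x ^ ((Fintype.card F - 1) * M) = -1} : Finset E) := by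
  simp [zero_pow (exponent_ne_zero hM)]

theorem exists_ne_zero_pow_ne {F E : Type*} [Field F] [Fintype F] [Field E] [Fintype E] {M : ℕ}
    (hM : (Fintype.card F - 1) * M * (Fintype.card F + 1) = Fintype.card E - 1) {c : E}
    (hc : c ^ (Fintype.card F + 1) = 1) :
    ∃ x : E, x ≠ 0 ∧ x ^ ((Fintype.card F - 1) * M) ≠ c := by
  classical
  by_contra! h
  have h1 : (univ.erase (0 : E)) ⊆
      ({x | x ^ ((Fintype.card F - 1) * M) = c} : Finset E) := fun x hx => by
    simpa using h x (by simpa using hx)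
  have h2 := card_le_card h1
  rw [card_pow_eq_of_mul_eq_card hM hc, card_erase_of_mem (mem_univ _), card_univ, ← hM] at h2
  have h3 := Nat.pos_of_ne_zero (exponent_ne_zero hM)
  have h4 : 1 < Fintype.card F := Fintype.one_lt_card
  nlinarith

section

variable {F E : Type*} [Field F] [Fintype F] [Field E] [Fintype E] [Algebra F E] {M : ℕ}

theorem card_filter_pow_eq_neg_one [DecidableEq E]
    (hM : (Fintype.card F - 1) * M * (Fintype.card F + 1) = Fintype.card E - 1) :
    #{x : E | x ^ ((Fintype.card F - 1) * M) = -1} = (Fintype.card F - 1) * M :=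
  card_pow_eq_of_mul_eq_card hM (neg_one_pow_card_add_one F)

theorem exists_pow_eq_neg_one_pow
    (hM : (Fintype.card F - 1) * M * (Fintype.card F + 1) = Fintype.card E - 1) :
    ∃ x : E, x ≠ 0 ∧ x ^ ((Fintype.card F - 1) * M) = (-1) ^ M := by
  obtain ⟨x, hx⟩ := exists_pow_eq_of_mul_eq_card hM (c := (-1) ^ M)
    (by rw [← pow_mul, mul_comm, pow_mul, neg_one_pow_card_add_one F, one_pow])
  refine ⟨x, ?_, hx⟩
  rintro rfl
  rw [zero_pow (exponent_ne_zero hM)] at hx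
  exact pow_ne_zero M (neg_ne_zero.2 one_ne_zero) hx.symm

end

/-! ### Weights and difference counts -/

section

variable {F E : Type*} [Field F] [Fintype F] [DecidableEq F] [Field E] [Fintype E]
  [DecidableEq E] [Algebra F E] {M k n : ℕ} {d : Fin n → E}

theorem length_eq_of_isShortenedDefiningSet
    (hM : (Fintype.card F - 1) * M * (Fintype.card F + 1) = Fintype.card E - 1)
    (hd : IsShortenedDefiningSet F
      (({x | x ^ ((Fintype.card F - 1) * M) = -1} : Finset E) : Set E) d) : n = M := by
  obtain ⟨ψ, hψ⟩ := exists_primitive_addChar F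
  -- At a = 0 the character sum is |D| = (q-1)M and the weight is 0.
  have h := sum_traceChar_of_isShortenedDefiningSet hψ (zero_notMem_filter_pow hM) hd 0
  have hq1 : 1 < Fintype.card F := Fintype.one_lt_card
  simp only [zero_mul, AddChar.map_zero_eq_one, sum_const, card_filter_pow_eq_neg_one hM,
    map_zero, ne_eq, not_true_eq_false, filter_false, card_empty, nsmul_eq_mul, mul_one] at h
  rw [← Nat.cast_pred (by omega), Nat.cast_zero, mul_zero, sub_zero] at h
  have h' : (Fintype.card F - 1) * M = (Fintype.card F - 1) * n := by exact_mod_cast h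
  exact (Nat.eq_of_mul_eq_mul_left (by omega) h').symm

theorem sum_traceChar_eq
    {ψ : AddChar F ℂ} (hψ : ψ.IsPrimitive)
    (hM : (Fintype.card F - 1) * M * (Fintype.card F + 1) = Fintype.card E - 1)
    (hd : IsShortenedDefiningSet F
      (({x | x ^ ((Fintype.card F - 1) * M) = -1} : Finset E) : Set E) d) (a : E) :
    ∑ x : E with x ^ ((Fintype.card F - 1) * M) = -1, traceChar E ψ (a * x) =
      (((Fintype.card F - 1) * M - Fintype.card F *
        #{i | Algebra.trace F E (a * d i) ≠ 0} : ℤ) : ℂ) := by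
  rw [sum_traceChar_of_isShortenedDefiningSet hψ (zero_notMem_filter_pow hM) hd,
    congrArg Nat.cast (length_eq_of_isShortenedDefiningSet hM hd)]
  push_cast; rfl

/-- The left side is the Hermitian sum at ga written through the weight. This makes every Hermitian
sum an integer congruent to 1 mod q+1, which is the input needed to evaluate it. -/
theorem weight_dichotomy
    (hM : (Fintype.card F - 1) * M * (Fintype.card F + 1) = Fintype.card E - 1)
    (hk : Fintype.card E = Fintype.card F ^ (2 * k))
    (hd : IsShortenedDefiningSet F
      (({x | x ^ ((Fintype.card F - 1) * M) = -1} : Finset E) : Set E) d) :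
    ∃ g : E, g ≠ 0 ∧ ∀ a : E, a ≠ 0 →
      1 + ((Fintype.card F : ℤ) + 1) * ((Fintype.card F - 1) * M -
        Fintype.card F * #{i | Algebra.trace F E (a * d i) ≠ 0}) =
      if (g * a) ^ ((Fintype.card F - 1) * M) = (-1) ^ M then
        -((-1) ^ k * (Fintype.card F : ℤ) ^ (k + 1)) else (-1) ^ k * (Fintype.card F : ℤ) ^ k := by
  obtain ⟨ψ, hψ⟩ := exists_primitive_addChar F
  obtain ⟨g, hg⟩ := exists_pow_eq_of_mul_eq_card hM (neg_one_pow_card_add_one F)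
  have hg0 : g ≠ 0 := by
    rintro rfl
    exact zero_notMem_filter_pow hM (by simpa using hg)
  have hS : ∀ a : E, hermitianSum ψ (g * a) =
      ((1 + ((Fintype.card F : ℤ) + 1) * ((Fintype.card F - 1) * M -
        Fintype.card F * #{i | Algebra.trace F E (a * d i) ≠ 0}) : ℤ) : ℂ) := fun a => by
    rw [hermitianSum_mul_eq ψ hM (neg_ne_zero.2 one_ne_zero) hg, sum_traceChar_eq hψ hM hd]
    push_cast; rfl
  have hint : ∀ a : E, ∃ z : ℤ, hermitianSum ψ a = 1 + (Fintype.card F + 1) * z := fun a => by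
    have h := hS (a / g)
    rw [mul_div_cancel₀ a hg0, Int.cast_add, Int.cast_mul, Int.cast_one, Int.cast_add,
      Int.cast_one, Int.cast_natCast] at h
    exact ⟨_, h⟩
  refine ⟨g, hg0, fun a ha => ?_⟩
  apply Int.cast_injective (α := ℂ)
  rw [← hS]
  split_ifs with h
  · rw [hermitianSum_of_pow_eq hψ hM hk hint h]; push_cast; rfl
  · rw [hermitianSum_of_pow_ne hψ hM hk hint (mul_ne_zero hg0 ha) h]; push_cast; rfl

theorem card_difference_eq
    (hM : (Fintype.card F - 1) * M * (Fintype.card F + 1) = Fintype.card E - 1)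
    (hk : Fintype.card E = Fintype.card F ^ (2 * (k + 1)))
    (hd : IsShortenedDefiningSet F
      (({x | x ^ ((Fintype.card F - 1) * M) = -1} : Finset E) : Set E) d) {D : Finset E}
    (hD : D = ({x | x ^ ((Fintype.card F - 1) * M) = -1} : Finset E)) {c : E} (hc : c ≠ 0) :
    (#{x ∈ D | c - x ∈ D} : ℚ) = if c ∈ D then
      ((Fintype.card F : ℚ) ^ (2 * (k + 1)) - 3 * Fintype.card F - 2 -
        (-1) ^ (k + 1) * (Fintype.card F : ℚ) ^ (k + 2) * (Fintype.card F - 1)) /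
        (Fintype.card F + 1) ^ 2
      else (Fintype.card F * ((Fintype.card F : ℚ) ^ (k + 1) - (-1) ^ (k + 1)) *
        ((Fintype.card F : ℚ) ^ k + (-1) ^ (k + 1))) / (Fintype.card F + 1) ^ 2 := by
  obtain ⟨ψ, hψ⟩ := exists_primitive_addChar F
  obtain ⟨g, hg0, hg⟩ := weight_dichotomy hM hk hd
  have hq1 : 1 < Fintype.card F := Fintype.one_lt_card
  set q := Fintype.card F with hq
  have hqC : (q : ℂ) + 1 ≠ 0 := by exact_mod_cast q.succ_ne_zero
  have hq0 : (q : ℂ) ≠ 0 := by exact_mod_cast (by omega : q ≠ 0)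
  set ε : ℂ := (-1) ^ (k + 1) with hε
  have hε2 : ε ^ 2 = 1 := by rw [hε, ← pow_mul, mul_comm, pow_mul]; simp
  set R : ℂ := (q : ℂ) ^ k with hR
  have hR0 : R ≠ 0 := pow_ne_zero _ hq0
  have hcard : (Fintype.card E : ℂ) = q ^ 2 * R ^ 2 := by
    rw [hk]; push_cast; ring
  have hKC : (#D : ℂ) = (q ^ 2 * R ^ 2 - 1) / (q + 1) := by
    rw [eq_div_iff hqC, ← hcard, hD, card_filter_pow_eq_neg_one hM,
      ← Nat.cast_pred Fintype.card_pos, ← hM]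
    push_cast; rfl
  -- The two arguments are the sum and the product of the Fourier values (S - 1)/(q+1), for S =
  -- εq^(k+1) and S = -εq^(k+2).
  have key := card_mul_card_filter_sub_mem (isPrimitive_traceChar hψ) D
    ((ε * q * R - 1) / (q + 1) + (-(ε * q ^ 2 * R) - 1) / (q + 1))
    ((ε * q * R - 1) / (q + 1) * ((-(ε * q ^ 2 * R) - 1) / (q + 1))) ?_ c
  · rw [if_neg hc, hcard, hKC, sub_zero] at key
    apply Rat.cast_injective (α := ℂ)
    have hcR : (q : ℂ) ^ 2 * R ^ 2 ≠ 0 := by positivity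
    apply mul_left_cancel₀ hcR
    rw [Rat.cast_natCast, key]
    split_ifs
    · push_cast
      rw [← hε, show (q : ℂ) ^ (2 * (k + 1)) = q ^ 2 * R ^ 2 by rw [hR]; ring,
        show (q : ℂ) ^ (k + 2) = q ^ 2 * R by rw [hR]; ring]
      field_simp
      linear_combination (-(q : ℂ) ^ 3 * R ^ 2) * hε2
    · push_cast
      rw [← hε, show (q : ℂ) ^ (k + 1) = q * R by rw [hR]; ring, ← hR]
      field_simp
      ring
  · intro a ha
    have h1 : 1 + ((q : ℂ) + 1) * (∑ x ∈ D, traceChar E ψ (a * x)) =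
        if (g * a) ^ ((q - 1) * M) = (-1) ^ M then
          -(ε * q ^ 2 * R) else ε * q * R := by
      rw [hD, sum_traceChar_eq hψ hM hd]
      have := congrArg (Int.cast : ℤ → ℂ) (hg a ha)
      push_cast at this ⊢
      rw [this, hR, hε]
      split_ifs <;> ring
    set W := ∑ x ∈ D, traceChar E ψ (a * x)
    have h2 : W = (ε * q * R - 1) / (q + 1) ∨ W = (-(ε * q ^ 2 * R) - 1) / (q + 1) := by
      rw [eq_div_iff hqC, eq_div_iff hqC]
      split_ifs at h1
      · right; linear_combination h1
      · left; linear_combination h1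
    rcases h2 with h2 | h2 <;> rw [h2] <;> ring

end

/-! ### The trace code, its dual and its columns -/

section

variable {F E : Type*} [Field F] [Field E] [Algebra F E] {n : ℕ}

/-- The encoding map `x ↦ (Tr (x d₁), …, Tr (x dₙ))`. -/
noncomputable def traceEncode (F : Type*) {E : Type*} [Field F] [Field E] [Algebra F E] {n : ℕ}
    (d : Fin n → E) : E →ₗ[F] Fin n → F :=
  LinearMap.pi fun i => Algebra.trace F E ∘ₗ LinearMap.mulRight F (d i)

@[simp]
theorem traceEncode_apply (d : Fin n → E) (x : E) (i : Fin n) :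
    traceEncode F d x i = Algebra.trace F E (x * d i) := rfl

theorem traceNormCode_self (d : Fin n → E) :
    traceNormCode F E d = LinearMap.range (traceEncode F d) := by
  simp [traceNormCode, traceEncode, Algebra.norm_self]

theorem ne_zero_of_isShortenedDefiningSet {D : Set E} (h0 : (0 : E) ∉ D) {d : Fin n → E}
    (hd : IsShortenedDefiningSet F D d) (i : Fin n) : d i ≠ 0 := fun hi =>
  h0 (hd.1 ▸ ⟨1, i, one_ne_zero, by rw [hi, mul_zero]⟩)

theorem isProjectiveCode_of_isShortenedDefiningSet [FiniteDimensional F E]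
    [Algebra.IsSeparable F E] {D : Set E} (h0 : (0 : E) ∉ D)
    {d : Fin n → E} (hd : IsShortenedDefiningSet F D d) :
    IsProjectiveCode (LinearMap.range (traceEncode F d)) := by
  classical
  intro y hy hy0
  have hd0 := ne_zero_of_isShortenedDefiningSet h0 hd
  -- By nondegeneracy of the trace form, a dual codeword is a linear relation among the dᵢ. One of
  -- weight 1 or 2 would make some dᵢ zero or two of them proportional.
  have hsum : ∑ i, algebraMap F E (y i) * d i = 0 := by
    refine (traceForm_nondegenerate F E).1 _ fun x => ?_
    rw [Algebra.traceForm_apply, sum_mul, map_sum]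
    rw [← hy _ ⟨x, rfl⟩]
    refine sum_congr rfl fun i _ => ?_
    rw [traceEncode_apply, mul_assoc, ← Algebra.smul_def, map_smul, smul_eq_mul, mul_comm x,
      mul_comm]
  have hnorm : hammingNorm y = #{i | y i ≠ 0} := by
    unfold hammingNorm; congr
  rw [← sum_subset (subset_univ ({i | y i ≠ 0} : Finset (Fin n)))
    (by intro i _ hi; simp at hi; simp [hi])] at hsum
  by_contra! hlt
  have hlt' : #{i | y i ≠ 0} < 3 := by
    rw [← hnorm]; convert hlt
  interval_cases hc : #{i | y i ≠ 0}
  · rw [card_eq_zero] at hc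
    apply hy0
    ext i
    by_contra hi
    exact notMem_empty i (hc ▸ by simpa using hi)
  · obtain ⟨i, hi⟩ := card_eq_one.1 hc
    have hyi : y i ≠ 0 := by
      have : i ∈ ({i | y i ≠ 0} : Finset (Fin n)) := hi ▸ mem_singleton_self i
      simpa using this
    rw [hi, sum_singleton] at hsum
    exact mul_ne_zero (by simpa using hyi) (hd0 i) hsum
  · obtain ⟨i, j, hij, hi⟩ := card_eq_two.1 hc
    have hyi : y i ≠ 0 := by
      have : i ∈ ({i | y i ≠ 0} : Finset (Fin n)) := hi ▸ by simp
      simpa using this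
    have hyj : y j ≠ 0 := by
      have : j ∈ ({i | y i ≠ 0} : Finset (Fin n)) := hi ▸ by simp
      simpa using this
    rw [hi, sum_pair hij] at hsum
    refine hd.2 i j hij (-y j / y i) (div_ne_zero (neg_ne_zero.2 hyj) hyi) ?_
    have hyi' : algebraMap F E (y i) ≠ 0 := by simpa using hyi
    rw [map_div₀, map_neg, div_eq_div_iff (hd0 j) hyi']
    linear_combination hsum

/-- The trace form identifies E with its dual. Under this, dᵢ becomes x ↦ Tr(x dᵢ), the i-th
coordinate of the codeword of x. -/
theorem exists_linearEquiv_dual_codeColumn [FiniteDimensional F E] [Algebra.IsSeparable F E]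
    {d : Fin n → E} (hinj : Function.Injective (traceEncode F d)) :
    ∃ e : E ≃ₗ[F] Module.Dual F (LinearMap.range (traceEncode F d)),
      ∀ i, e (d i) = codeColumn (LinearMap.range (traceEncode F d)) i := by
  let f := LinearEquiv.ofInjective (traceEncode F d) hinj
  refine ⟨((Algebra.traceForm F E).toDual (traceForm_nondegenerate F E)).trans f.symm.dualMap,
    fun i => ?_⟩
  ext c
  obtain ⟨x, rfl⟩ := f.surjective c
  simp only [LinearEquiv.trans_apply, LinearEquiv.dualMap_apply, LinearEquiv.symm_apply_apply,
    LinearMap.BilinForm.toDual_def, Algebra.traceForm_apply]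
  rw [mul_comm]
  rfl

theorem codeGraph_adj_iff {D : Set E} (h0 : (0 : E) ∉ D)
    {d : Fin n → E} (hd : IsShortenedDefiningSet F D d) {C : Submodule F (Fin n → F)}
    (e : E ≃ₗ[F] Module.Dual F C) (he : ∀ i, e (d i) = codeColumn C i) (x y : E) :
    (codeGraph C).Adj (e x) (e y) ↔ x - y ∈ D := by
  have hd0 := ne_zero_of_isShortenedDefiningSet h0 hd
  simp only [codeGraph, ← he, ← map_sub, ← map_smul, EmbeddingLike.apply_eq_iff_eq, ne_eq,
    Algebra.smul_def, hd.1, Set.mem_ofPred_eq]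
  constructor
  · rintro ⟨hxy, u, i, h⟩
    refine ⟨u, i, ?_, h⟩
    rintro rfl
    rw [map_zero, zero_mul, sub_eq_zero] at h
    exact hxy h
  · rintro ⟨u, i, hu, h⟩
    refine ⟨?_, u, i, h⟩
    rintro rfl
    rw [sub_self] at h
    exact mul_ne_zero (by simpa using hu) (hd0 i) h.symm

end

/-! ### The two-weight property and the strongly regular graph -/

section

variable {F E : Type*} [Field F] [Fintype F] [Field E] [Fintype E] [DecidableEq E] [Algebra F E]
  {M k n : ℕ} {d : Fin n → E}

/-- With Q = q^(k+1), a codeword of weight 0 at some a ≠ 0 would give a Hermitian sum Q², whereas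
its values are at most qQ; but Q ≥ q² since k ≥ 1. -/
theorem traceEncode_injective (hk0 : 1 ≤ k)
    (hM : (Fintype.card F - 1) * M * (Fintype.card F + 1) = Fintype.card E - 1)
    (hk : Fintype.card E = Fintype.card F ^ (2 * (k + 1)))
    (hd : IsShortenedDefiningSet F
      (({x | x ^ ((Fintype.card F - 1) * M) = -1} : Finset E) : Set E) d) :
    Function.Injective (traceEncode F d) := by
  classical
  obtain ⟨g, -, hg⟩ := weight_dichotomy hM hk hd
  rw [injective_iff_map_eq_zero]
  intro a ha
  by_contra ha0
  have h1 := hg a ha0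
  have hw : #{i | Algebra.trace F E (a * d i) ≠ 0} = 0 := by
    rw [card_eq_zero, filter_eq_empty_iff]
    intro i _ h
    exact h (congrFun ha i)
  have hq1 : 1 < Fintype.card F := Fintype.one_lt_card
  have hMZ : ((Fintype.card F : ℤ) - 1) * M * (Fintype.card F + 1) =
      (Fintype.card F : ℤ) ^ (2 * (k + 1)) - 1 := by
    have := congrArg (Nat.cast : ℕ → ℤ) hM
    rw [Nat.cast_mul, Nat.cast_mul, Nat.cast_pred (by omega), Nat.cast_pred Fintype.card_pos,
      hk] at this
    exact_mod_cast this
  rw [hw, Nat.cast_zero, mul_zero, sub_zero, pow_succ _ (k + 1)] at h1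
  have hqZ : (1 : ℤ) < Fintype.card F := by exact_mod_cast hq1
  have hQ : (Fintype.card F : ℤ) ^ 2 ≤ (Fintype.card F : ℤ) ^ (k + 1) :=
    pow_le_pow_right₀ hqZ.le (by omega)
  have hMQ : 1 + ((Fintype.card F : ℤ) + 1) * ((Fintype.card F - 1) * M) =
      (Fintype.card F : ℤ) ^ (k + 1) * (Fintype.card F : ℤ) ^ (k + 1) := by
    linear_combination hMZ
  rw [hMQ] at h1
  have hε : ((-1 : ℤ) ^ (k + 1)) = 1 ∨ ((-1 : ℤ) ^ (k + 1)) = -1 := neg_one_pow_eq_or ℤ _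
  generalize (Fintype.card F : ℤ) ^ (k + 1) = Q at *
  generalize (Fintype.card F : ℤ) = q at *
  have hQ0 : 0 < Q := by nlinarith
  have h3 : Q * Q ≤ Q * q := by
    rw [h1]
    split_ifs <;> rcases hε with h | h <;> rw [h] <;> nlinarith
  have h4 := le_of_mul_le_mul_left h3 hQ0
  nlinarith

theorem isTwoWeightCode_of_isShortenedDefiningSet (hk0 : 1 ≤ k)
    (hM : (Fintype.card F - 1) * M * (Fintype.card F + 1) = Fintype.card E - 1)
    (hk : Fintype.card E = Fintype.card F ^ (2 * (k + 1)))
    (hd : IsShortenedDefiningSet F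
      (({x | x ^ ((Fintype.card F - 1) * M) = -1} : Finset E) : Set E) d) :
    IsTwoWeightCode (LinearMap.range (traceEncode F d)) := by
  classical
  have hinj := traceEncode_injective hk0 hM hk hd
  obtain ⟨g, hg0, hg⟩ := weight_dichotomy hM hk hd
  have hnormw : ∀ a, #{i | Algebra.trace F E (a * d i) ≠ 0} =
      hammingNorm (traceEncode F d a) := fun a => by
    simp only [hammingNorm, traceEncode_apply]
    congr
  simp only [hnormw] at hg
  -- Both cases of the dichotomy occur: b₁ and b₂ lie off and on the exceptional coset.
  obtain ⟨b₁, hb₁, hb₁'⟩ := exists_ne_zero_pow_ne hM (c := (-1 : E) ^ M)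
    (by rw [← pow_mul, mul_comm, pow_mul, neg_one_pow_card_add_one F, one_pow])
  obtain ⟨b₂, hb₂, hb₂'⟩ := exists_pow_eq_neg_one_pow (F := F) hM
  have hw₁ := hg (b₁ / g) (div_ne_zero hb₁ hg0)
  have hw₂ := hg (b₂ / g) (div_ne_zero hb₂ hg0)
  rw [mul_div_cancel₀ _ hg0, if_neg hb₁'] at hw₁
  rw [mul_div_cancel₀ _ hg0, if_pos hb₂'] at hw₂
  have hcancel : ∀ a b : ℕ, 1 + ((Fintype.card F : ℤ) + 1) * ((Fintype.card F - 1) * M -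
      Fintype.card F * a) = 1 + ((Fintype.card F : ℤ) + 1) * ((Fintype.card F - 1) * M -
      Fintype.card F * b) → a = b := by
    intro a b h
    have hq2 : ((Fintype.card F : ℤ) + 1) * Fintype.card F ≠ 0 := by positivity
    have h2 : ((Fintype.card F : ℤ) + 1) * Fintype.card F * a =
        ((Fintype.card F : ℤ) + 1) * Fintype.card F * b := by
      linear_combination -h
    exact_mod_cast mul_left_cancel₀ hq2 h2
  refine ⟨hammingNorm (traceEncode F d (b₁ / g)), hammingNorm (traceEncode F d (b₂ / g)), ?_, ?_⟩
  · intro h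
    have h' : hammingNorm (traceEncode F d (b₁ / g)) = hammingNorm (traceEncode F d (b₂ / g)) := by
      convert h
    rw [h', hw₂, pow_succ _ (k + 1)] at hw₁
    have hε : ((-1 : ℤ) ^ (k + 1)) = 1 ∨ ((-1 : ℤ) ^ (k + 1)) = -1 := neg_one_pow_eq_or ℤ _
    have hqpow : (0 : ℤ) < (Fintype.card F : ℤ) ^ (k + 1) := by positivity
    have hq : (0 : ℤ) < (Fintype.card F : ℤ) := by positivity
    rcases hε with h | h <;> rw [h] at hw₁ <;> nlinarith
  · ext v
    simp only [Set.mem_ofPred_eq, Set.mem_insert_iff, Set.mem_singleton_iff]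
    constructor
    · rintro ⟨_, ⟨a, rfl⟩, ha, rfl⟩
      have ha0 : a ≠ 0 := fun h => ha (by rw [h, map_zero])
      have h1 := hg a ha0
      split_ifs at h1
      · right
        convert hcancel _ _ (h1.trans hw₂.symm)
      · left
        convert hcancel _ _ (h1.trans hw₁.symm)
    · rintro (rfl | rfl)
      · exact ⟨_, ⟨_, rfl⟩, (map_ne_zero_iff _ hinj).2 (div_ne_zero hb₁ hg0), rfl⟩
      · exact ⟨_, ⟨_, rfl⟩, (map_ne_zero_iff _ hinj).2 (div_ne_zero hb₂ hg0), rfl⟩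

theorem exists_isConnectedSRG_codeGraph [FiniteDimensional F E] (hk0 : 1 ≤ k)
    (hM : (Fintype.card F - 1) * M * (Fintype.card F + 1) = Fintype.card E - 1)
    (hk : Fintype.card E = Fintype.card F ^ (2 * (k + 1)))
    (hd : IsShortenedDefiningSet F
      (({x | x ^ ((Fintype.card F - 1) * M) = -1} : Finset E) : Set E) d) :
    ∃ l μ : ℕ,
      (l : ℚ) = ((Fintype.card F : ℚ) ^ (2 * (k + 1)) - 3 * Fintype.card F - 2 -
        (-1) ^ (k + 1) * (Fintype.card F : ℚ) ^ (k + 2) * (Fintype.card F - 1)) /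
          (Fintype.card F + 1) ^ 2 ∧
      (μ : ℚ) = (Fintype.card F * ((Fintype.card F : ℚ) ^ (k + 1) - (-1) ^ (k + 1)) *
        ((Fintype.card F : ℚ) ^ k + (-1) ^ (k + 1))) / (Fintype.card F + 1) ^ 2 ∧
      IsConnectedSRG (codeGraph (LinearMap.range (traceEncode F d)))
        (Fintype.card F ^ (2 * (k + 1))) ((Fintype.card F - 1) * M) l μ := by
  classical
  obtain ⟨e, he⟩ := exists_linearEquiv_dual_codeColumn (traceEncode_injective hk0 hM hk hd)
  obtain ⟨c₁, hc₁⟩ := exists_pow_eq_of_mul_eq_card hM (neg_one_pow_card_add_one F (E := E))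
  obtain ⟨c₂, hc₂, hc₂'⟩ := exists_ne_zero_pow_ne hM (neg_one_pow_card_add_one F (E := E))
  have h0 := zero_notMem_filter_pow hM
  have hK := card_filter_pow_eq_neg_one hM
  have hdiff := fun c (hc : c ≠ 0) => card_difference_eq hM hk hd rfl hc
  have hc₁D : c₁ ∈ ({x | x ^ ((Fintype.card F - 1) * M) = -1} : Finset E) := by simpa using hc₁
  have hc₂D : c₂ ∉ ({x | x ^ ((Fintype.card F - 1) * M) = -1} : Finset E) := by simpa using hc₂'
  generalize ({x | x ^ ((Fintype.card F - 1) * M) = -1} : Finset E) = D at *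
  have hl := hdiff c₁ fun h => h0 (h ▸ hc₁D)
  have hμ := hdiff c₂ hc₂
  rw [if_pos hc₁D] at hl
  rw [if_neg hc₂D] at hμ
  -- The naturals λ and μ are the actual counts at the sample points c₁ in D and c₂ outside D ∪ {0},
  -- so integrality of the formulas needs no arithmetic.
  refine ⟨_, _, hl, hμ, ?_⟩
  rw [← hk, ← hK]
  refine isConnectedSRG_of_adj_iff e.toEquiv (D := D)
    (codeGraph_adj_iff (by simpa using h0) hd e he) ?_ ?_ ?_
  · rw [← Nat.cast_pos (α := ℚ), hμ]
    have hq : (1 : ℚ) < Fintype.card F := by exact_mod_cast Fintype.one_lt_card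
    have h1 : (1 : ℚ) < (Fintype.card F : ℚ) ^ k := one_lt_pow₀ hq (by omega)
    have h2 : (1 : ℚ) < (Fintype.card F : ℚ) ^ (k + 1) := one_lt_pow₀ hq (by omega)
    have hε : ((-1 : ℚ) ^ (k + 1)) = 1 ∨ ((-1 : ℚ) ^ (k + 1)) = -1 := neg_one_pow_eq_or ℚ _
    apply div_pos _ (by positivity)
    apply mul_pos (mul_pos (by positivity) _) <;> rcases hε with h | h <;> rw [h] <;> linarith
  · intro c hc
    have h1 := hdiff c fun h => h0 (h ▸ hc)
    rw [if_pos hc, ← hl] at h1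
    exact_mod_cast h1
  · intro c hc hcD
    have h1 := hdiff c hc
    rw [if_neg hcD, ← hμ] at h1
    exact_mod_cast h1

end

/-! ### Assembly over an arbitrary field tower -/

/-- The parameters of the strongly regular graphs attached to the defining set
`Tr (N x) = 0`, together with the properties of the shortened code. -/
theorem shortenedCode_properties {F L E : Type*} [Field F] [Field L] [Field E] [Algebra F L]
    [Algebra L E] [Algebra F E] [IsScalarTower F L E] {q k : ℕ} (hq : IsPrimePow q) (hk : 1 ≤ k)
    (hF : Nat.card F = q) (hL : Module.finrank F L = 2)
    (hE : Module.finrank F E = 2 * (k + 1)) :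
    (∃ (n : ℕ) (d : Fin n → E), IsShortenedDefiningSet F (definingSet F L E 0) d) ∧
    ∀ (n : ℕ) (d : Fin n → E), IsShortenedDefiningSet F (definingSet F L E 0) d →
      (n : ℚ) = ((q : ℚ) ^ (2 * (k + 1)) - 1) / ((q : ℚ) ^ 2 - 1) ∧
      Module.finrank F (traceNormCode F E d) = 2 * (k + 1) ∧
      IsProjectiveCode (traceNormCode F E d) ∧
      IsTwoWeightCode (traceNormCode F E d) ∧
      ∃ K l μ : ℕ,
        (K : ℚ) = ((q : ℚ) ^ (2 * (k + 1)) - 1) / (q + 1) ∧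
        (l : ℚ) = ((q : ℚ) ^ (2 * (k + 1)) - 3 * q - 2 -
          (-1) ^ (k + 1) * (q : ℚ) ^ (k + 2) * (q - 1)) / (q + 1) ^ 2 ∧
        (μ : ℚ) = (q * ((q : ℚ) ^ (k + 1) - (-1) ^ (k + 1)) *
          ((q : ℚ) ^ k + (-1) ^ (k + 1))) / (q + 1) ^ 2 ∧
        IsConnectedSRG (codeGraph (traceNormCode F E d)) (q ^ (2 * (k + 1))) K l μ := by
  classical
  have hFfin : Finite F := Nat.finite_of_card_ne_zero (hF ▸ hq.pos.ne')
  have : FiniteDimensional F L := Module.finite_of_finrank_pos (by omega)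
  have : FiniteDimensional F E := Module.finite_of_finrank_pos (by omega)
  have hLfin : Finite L := Module.finite_of_finite F
  have hEfin : Finite E := Module.finite_of_finite F
  let _ : Fintype F := Fintype.ofFinite F
  let _ : Fintype E := Fintype.ofFinite E
  rw [Nat.card_eq_fintype_card] at hF
  subst hF
  set q := Fintype.card F with hqdef
  have hq1 : 1 < q := Fintype.one_lt_card
  have hcard : Fintype.card E = q ^ (2 * (k + 1)) := by
    rw [Module.card_eq_pow_finrank (K := F), hE]
  obtain ⟨M, hM'⟩ : q ^ 2 - 1 ∣ q ^ (2 * (k + 1)) - 1 := by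
    simpa [pow_mul] using Nat.sub_dvd_pow_sub_pow (q ^ 2) 1 (k + 1)
  have hM : (q - 1) * M * (q + 1) = Fintype.card E - 1 := by
    rw [hcard, hM', show q ^ 2 - 1 = (q + 1) * (q - 1) by simpa using Nat.sq_sub_sq q 1]
    ring
  set D : Finset E := {x | x ^ ((q - 1) * M) = -1} with hD
  have hDset : definingSet F L E 0 = (D : Set E) := by
    ext x
    rw [mem_definingSet_zero_iff hL hM, mem_coe, hD, mem_filter]
    exact (and_iff_right (mem_univ x)).symm
  have h0 : (0 : E) ∉ (D : Set E) := zero_notMem_filter_pow hM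
  rw [hDset]
  refine ⟨exists_isShortenedDefiningSet h0 fun u x hu hx => ?_, fun n d hd => ?_⟩
  · rw [hD, mem_coe, mem_filter] at hx ⊢
    refine ⟨mem_univ _, ?_⟩
    rw [mul_pow, hx.2, ← map_pow, pow_mul, FiniteField.pow_card_sub_one_eq_one u hu]
    simp
  have hn := length_eq_of_isShortenedDefiningSet hM hd
  have hinj := traceEncode_injective hk hM hcard hd
  have hqQ : (1 : ℚ) < q := by exact_mod_cast hq1
  have hMQ : ((q : ℚ) - 1) * M * (q + 1) = (q : ℚ) ^ (2 * (k + 1)) - 1 := by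
    have := congrArg (Nat.cast : ℕ → ℚ) hM
    rw [Nat.cast_mul, Nat.cast_mul, Nat.cast_pred (by omega), Nat.cast_pred Fintype.card_pos,
      hcard] at this
    exact_mod_cast this
  rw [traceNormCode_self]
  refine ⟨?_, ?_, isProjectiveCode_of_isShortenedDefiningSet h0 hd,
    isTwoWeightCode_of_isShortenedDefiningSet hk hM hcard hd, ?_⟩
  · rw [hn, ← hMQ]
    have : (q : ℚ) ^ 2 - 1 ≠ 0 := by nlinarith
    rw [eq_div_iff this]; ring
  · rw [LinearMap.finrank_range_of_inj hinj, hE]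
  · obtain ⟨l, μ, hl, hμ, h⟩ := exists_isConnectedSRG_codeGraph hk hM hcard hd
    refine ⟨(q - 1) * M, l, μ, ?_, hl, hμ, h⟩
    rw [eq_div_iff (by positivity), ← hMQ, Nat.cast_mul, Nat.cast_pred (by omega)]

theorem exists_finite_field_tower {q k : ℕ} (hq : IsPrimePow q) (hk : k ≠ 0) :
    ∃ (F L E : Type) (_ : Field F) (_ : Field L) (_ : Field E) (_ : Algebra F L)
      (_ : Algebra L E) (_ : Algebra F E), IsScalarTower F L E ∧ Nat.card F = q ∧
      Module.finrank F L = 2 ∧ Module.finrank F E = 2 * k := by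
  obtain ⟨p, r, hp, hr, rfl⟩ := hq
  have : Fact p.Prime := ⟨hp.nat_prime⟩
  have : NeZero k := ⟨hk⟩
  let F := GaloisField p r
  let L := FiniteField.Extension F p 2
  have : CharP L p := charP_of_injective_algebraMap (algebraMap F L).injective p
  have : Finite L := Module.finite_of_finite F
  let E := FiniteField.Extension L p k
  let _ : Algebra F E := ((algebraMap L E).comp (algebraMap F L)).toAlgebra
  have : IsScalarTower F L E := IsScalarTower.of_algebraMap_eq fun _ => rfl
  refine ⟨F, L, E, inferInstance, inferInstance, inferInstance, inferInstance, inferInstance,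
    inferInstance, this, GaloisField.card p r hr.ne', FiniteField.finrank_extension F p 2, ?_⟩
  rw [← Module.finrank_mul_finrank F L E, FiniteField.finrank_extension F p 2,
    FiniteField.finrank_extension L p k]

end

theorem theorem5p6 (q m : ℕ) (hq : IsPrimePow q) (hm : 2 ∣ m) (hm4 : 4 ≤ m) :
    ∃ K l μ : ℕ,
      (K : ℚ) = ((q : ℚ) ^ m - 1) / (q + 1) ∧
      (l : ℚ) = ((q : ℚ) ^ m - 3 * q - 2 - (-1) ^ (m / 2) * (q : ℚ) ^ (m / 2 + 1) * (q - 1)) /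
        (q + 1) ^ 2 ∧
      (μ : ℚ) = (q * ((q : ℚ) ^ (m / 2) - (-1) ^ (m / 2)) *
        ((q : ℚ) ^ (m / 2 - 1) + (-1) ^ (m / 2))) / (q + 1) ^ 2 ∧
      -- existence of the strongly regular graph
      (∃ G : SimpleGraph (Fin (q ^ m)), IsConnectedSRG G (q ^ m) K l μ) ∧
      -- it is the graph of the shortened code, where `m₁ = m`, `m₂ = 2`, `a = 0`
      ∀ (F L E : Type*) [Field F] [Field L] [Field E] [Algebra F L] [Algebra L E] [Algebra F E]
        [IsScalarTower F L E],
        Nat.card F = q → Module.finrank F L = 2 → Module.finrank F E = m →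
        (∃ (n : ℕ) (d : Fin n → E), IsShortenedDefiningSet F (definingSet F L E 0) d) ∧
        ∀ (n : ℕ) (d : Fin n → E), IsShortenedDefiningSet F (definingSet F L E 0) d →
          (n : ℚ) = ((q : ℚ) ^ m - 1) / ((q : ℚ) ^ 2 - 1) ∧
          Module.finrank F (traceNormCode F E d) = m ∧
          IsProjectiveCode (traceNormCode F E d) ∧
          IsTwoWeightCode (traceNormCode F E d) ∧
          IsConnectedSRG (codeGraph (traceNormCode F E d)) (q ^ m) K l μ := by
  obtain ⟨k, rfl⟩ := hm
  obtain ⟨k, rfl⟩ : ∃ j, k = j + 1 := ⟨k - 1, by omega⟩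
  have e1 : 2 * (k + 1) / 2 = k + 1 := by omega
  rw [e1, Nat.add_sub_cancel]
  -- One concrete tower supplies K, λ, μ and the graph. Any other tower yields the same naturals, as
  -- their rational values depend only on q and m.
  obtain ⟨F, L, E, _, _, _, _, _, _, _, hF, hL, hE⟩ :=
    exists_finite_field_tower hq k.succ_ne_zero
  obtain ⟨⟨n, d, hd⟩, h⟩ := shortenedCode_properties hq (by omega) hF hL hE
  obtain ⟨-, -, -, -, K, l, μ, hK, hl, hμ, hG⟩ := h n d hd
  refine ⟨K, l, μ, hK, hl, hμ, ?_, ?_⟩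
  · obtain ⟨-, _, _, hs⟩ := id hG
    let f := Fintype.equivFinOfCardEq hs.card
    exact ⟨(codeGraph (traceNormCode F E d)).map f.toEmbedding,
      isConnectedSRG_congr (SimpleGraph.Iso.map f _) hG⟩
  · intro F' L' E' _ _ _ _ _ _ _ hF' hL' hE'
    obtain ⟨hex, h'⟩ := shortenedCode_properties hq (by omega) hF' hL' hE'
    refine ⟨hex, fun n' d' hd' => ?_⟩
    obtain ⟨h1, h2, h3, h4, K', l', μ', hK', hl', hμ', hG'⟩ := h' n' d' hd'
    rw [← hK, Nat.cast_inj] at hK'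
    rw [← hl, Nat.cast_inj] at hl'
    rw [← hμ, Nat.cast_inj] at hμ'
    subst hK' hl' hμ'
    exact ⟨h1, h2, h3, h4, hG'⟩
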